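/- Let $\mathbb P=(P;\le)$ be the random partial order, that is, the (up to isomorphism unique) countable partial order which contains every finite partial order as an induced suborder and in which every isomorphism between finite induced suborders extends to an automorphism of $\mathbb P$. Write $x\perp y$ if $x,y\in P$ are incomparable. A group $G\le \mathrm{Sym}(P)$ is closed if it is closed in $\mathrm{Sym}(P)$ for the topology of pointwise convergence ($P$ discrete), i.e. if it contains every permutation of $P$ that agrees on each finite subset of $P$ with some element of $G$; $\langle A\rangle$ denotes the smallest closed subgroup of $\mathrm{Sym}(P)$ containing $A$. A reversal is a permutation $\updownarrow$ of $P$ with $\updownarrow(x)\le\updownarrow(y)\iff y\le x$ for all $x,y$. A random filter is an upward closed set $F\subseteq P$ such that $(P;\le,F)$ contains every finite partial order with a distinguished upward closed subset as an induced substructure, and every isomorphism between finite induced substructures of $(P;\le,F)$ extends to an automorphism of $(P;\le,F)$. A turn around $F$ is a permutation $\circlearrowright_F$ of $P$ such that for all $x,y\in P$, $\circlearrowright_F(x)<\circlearrowright_F(y)$ if and only if either $x<y$ and $x,y$ are both in $F$ or both outside $F$, or $x\in F$, $y\notin F$ and $x\perp y$. Let $\mathrm{cyc}\subseteq P^3$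 be the set of all $(a,b,c)$ such that one of the following holds: $a<b<c$; $b<c<a$; $c<a<b$; $(a<b,\ c\perp a,\ c\perp b)$; $(b<c,\ a\perp b,\ a\perp c)$; $(c<a,\ b\perp a,\ b\perp c)$. Let $\mathrm{pari}\subseteq P^3$ be the set of all $(a,b,c)$ such that $a,b,c$ are pairwise incomparable, or one of them is strictly below both of the other two and these two are incomparable, or one of them is strictly above both of the other two and these two are incomparable. Then reversals and random filters exist, and for every random filter $F$ there is a turn around $F$. Moreover, for any reversal $\updownarrow$, any random filter $F$ and any turn $\circlearrowright_F$ around $F$, put $$R=\langle \mathrm{Aut}(\mathbb P)\cup\{\updownarrow\}\rangle,\quad T=\langle \mathrm{Aut}(\mathbb P)\cup\{\circlearrowright_F\}\rangle,\quad M=\langle \mathrm{Aut}(\mathbb P)\cup\{\updownarrow,\circlearrowright_F\}\rangle .$$ Then $$R=\mathrm{Aut}(P;\perp),\qquad T=\mathrm{Aut}(P;\mathrm{cyc}),\qquad M=\mathrm{Aut}(P;\mathrm{pari}),$$ where $\mathrm{Aut}(P;\rho)$ is the group of permutations $f$ of $P$ such that $f$ and $f^{-1}$ preserve $\rho$. Furthermore,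 under the componentwise action of $T$ on $P^3$, $\mathrm{cyc}$ is the orbit of every triple $(a,b,c)$ with $a<b<c$, and $\mathrm{pari}$ is the orbit of every triple $(a,b,c)$ of pairwise incomparable elements. -/

import Mathlib

namespace RandomPoset

/-- `P` is (a copy of) the random partial order: the countable partial order that contains every
finite partial order as an induced suborder and is homogeneous, i.e. every isomorphism between
finite induced suborders extends to an automorphism. -/
structure IsRandomPoset (P : Type*) [PartialOrder P] : Prop where
  countable : Countable P
  universal : ∀ (Q : Type) [Finite Q] [PartialOrder Q], Nonempty (Q ↪o P)
  homogeneous : ∀ (S : Finset P) (f : P → P),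
    (∀ x ∈ S, ∀ y ∈ S, f x ≤ f y ↔ x ≤ y) → ∃ g : P ≃o P, ∀ x ∈ S, g x = f x

/-- `F` is a random filter of `P`: an upward closed subset such that the structure `(P; ≤, F)` is
universal and homogeneous for the class of all finite partial orders with a distinguished upward
closed subset (it is the Fraïssé limit of that class when `P` is countable). -/
structure IsRandomFilter {P : Type*} [PartialOrder P] (F : Set P) : Prop where
  upper : IsUpperSet F
  universal : ∀ (Q : Type) [Finite Q] [PartialOrder Q] (U : Set Q), IsUpperSet U →
    ∃ e : Q ↪o P, ∀ q, e q ∈ F ↔ q ∈ U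
  homogeneous : ∀ (S : Finset P) (f : P → P),
    (∀ x ∈ S, ∀ y ∈ S, f x ≤ f y ↔ x ≤ y) → (∀ x ∈ S, f x ∈ F ↔ x ∈ F) →
    ∃ g : P ≃o P, (∀ x, g x ∈ F ↔ x ∈ F) ∧ ∀ x ∈ S, g x = f x

/-- `a ⊥ b`: `a` and `b` are incomparable. -/
def Incomp {P : Type*} [PartialOrder P] (a b : P) : Prop :=
  ¬ a ≤ b ∧ ¬ b ≤ a

/-- The permutation `r` reverses the order. -/
def IsReversal {P : Type*} [PartialOrder P] (r : Equiv.Perm P) : Prop :=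
  ∀ a b, r a ≤ r b ↔ b ≤ a

/-- The permutation `t` turns the order around `F`: it keeps the order inside `F` and inside the
complement of `F`, and for `x ∈ F`, `y ∉ F` it makes `x` smaller than `y` if they were
incomparable, and incomparable to `y` if they were comparable. -/
def IsTurn {P : Type*} [PartialOrder P] (F : Set P) (t : Equiv.Perm P) : Prop :=
  ∀ x y, t x < t y ↔ ((x ∈ F ↔ y ∈ F) ∧ x < y) ∨ (x ∈ F ∧ y ∉ F ∧ Incomp x y)

/-- A permutation group on `P` is closed (in `Sym(P)` with the topology of pointwise convergence,
`P` being discrete) if it contains every permutation that agrees on each finite set with some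
member of the group. -/
def IsClosedGroup {P : Type*} (G : Subgroup (Equiv.Perm P)) : Prop :=
  ∀ f : Equiv.Perm P, (∀ S : Finset P, ∃ g ∈ G, ∀ x ∈ S, g x = f x) → f ∈ G

/-- The smallest closed permutation group on `P` that contains `A`. -/
def closedGroup {P : Type*} (A : Set (Equiv.Perm P)) : Subgroup (Equiv.Perm P) :=
  sInf {G | IsClosedGroup G ∧ A ⊆ G}

/-- `Aut(P; ρ)` for a binary relation `ρ`. -/
def autBinary {P : Type*} (ρ : P → P → Prop) : Subgroup (Equiv.Perm P) where
  carrier := {f | ∀ a b, ρ (f a) (f b) ↔ ρ a b}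
  mul_mem' := fun hf hg a b => (hf _ _).trans (hg a b)
  one_mem' := fun _ _ => Iff.rfl
  inv_mem' := fun {f} hf a b => by
    have h := hf (f⁻¹ a) (f⁻¹ b)
    simpa using h.symm

/-- `Aut(P; ρ)` for a ternary relation `ρ`. -/
def autTernary {P : Type*} (ρ : P → P → P → Prop) : Subgroup (Equiv.Perm P) where
  carrier := {f | ∀ a b c, ρ (f a) (f b) (f c) ↔ ρ a b c}
  mul_mem' := fun hf hg a b c => (hf _ _ _).trans (hg a b c)
  one_mem' := fun _ _ _ => Iff.rfl
  inv_mem' := fun {f} hf a b c => by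
    have h := hf (f⁻¹ a) (f⁻¹ b) (f⁻¹ c)
    simpa using h.symm

/-- `Aut(P; ≤)`, as a group of permutations. -/
def autOrder (P : Type*) [PartialOrder P] : Subgroup (Equiv.Perm P) :=
  autBinary (fun a b : P => a ≤ b)

/-- The closed group generated by the order automorphisms and the reversal `r`. -/
def groupR {P : Type*} [PartialOrder P] (r : Equiv.Perm P) : Subgroup (Equiv.Perm P) :=
  closedGroup ((autOrder P : Set (Equiv.Perm P)) ∪ {r})

/-- The closed group generated by the order automorphisms and the turn `t`. -/
def groupT {P : Type*} [PartialOrder P] (t : Equiv.Perm P) : Subgroup (Equiv.Perm P) :=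
  closedGroup ((autOrder P : Set (Equiv.Perm P)) ∪ {t})

/-- The closed group generated by the order automorphisms, the reversal `r` and the turn `t`. -/
def groupM {P : Type*} [PartialOrder P] (r t : Equiv.Perm P) : Subgroup (Equiv.Perm P) :=
  closedGroup ((autOrder P : Set (Equiv.Perm P)) ∪ {r, t})

/-- The ternary relation `cyc`. -/
def Cyc {P : Type*} [PartialOrder P] (a b c : P) : Prop :=
  (a < b ∧ b < c) ∨ (b < c ∧ c < a) ∨ (c < a ∧ a < b) ∨
  (a < b ∧ Incomp c a ∧ Incomp c b) ∨
  (b < c ∧ Incomp a b ∧ Incomp a c) ∨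
  (c < a ∧ Incomp b a ∧ Incomp b c)

/-- The ternary relation `pari`. -/
def Pari {P : Type*} [PartialOrder P] (a b c : P) : Prop :=
  (Incomp a b ∧ Incomp b c ∧ Incomp c a) ∨
  (a < b ∧ a < c ∧ Incomp b c) ∨ (b < a ∧ b < c ∧ Incomp a c) ∨ (c < a ∧ c < b ∧ Incomp a b) ∨
  (b < a ∧ c < a ∧ Incomp b c) ∨ (a < b ∧ c < b ∧ Incomp a c) ∨ (a < c ∧ b < c ∧ Incomp a b)

/-- The set of triples in the orbit of `(a, b, c)` under the componentwise action of `G`. -/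
def tripleOrbit {P : Type*} (G : Subgroup (Equiv.Perm P)) (a b c : P) : Set (P × P × P) :=
  {v | ∃ g ∈ G, v = (g a, g b, g c)}

end RandomPoset

/-! Encode the order by the antisymmetric function `cmpSign` with values -1, 0, 1, and let `triSign`
be its coboundary. Transitivity keeps `triSign` in {-1, 0, 1}; `Cyc` is the set where it equals 1,
and `Pari` is the set of triples of distinct points where it vanishes. A turn around `F` adds to
`cmpSign` the coboundary of the indicator of `F` (`IsTurn.cmpSign`), so it preserves `triSign`,
while a reversal negates it. Hence T preserves `Cyc` and M preserves `Pari`.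

Conversely, let a finite injection preserve `triSign`. It changes `cmpSign` by the coboundary of an
integer function `k`, which after a normalisation takes values in {0, 1, 2}. Such a change is the
composite of two turns around the level sets of `k`, realised in T (`exists_shift_on`), and
homogeneity supplies the remaining automorphism (`exists_mem_groupT_eq_on`). As T is closed, this
gives T and its orbits on triples.

For R and M it remains to see that a permutation acts with one global sign: on comparable pairs for
R, on triples with `triSign` 1 for M. Both follow from the connectedness of comparable pairs
(`HasExtensions.comparable_pair_induction`). For M, a member of T first makes a base point
incomparable to the other points, so that `triSign` at that point becomes `cmpSign`. If the sign is
negative, composing with the reversal makes it positive.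

Reversals, random filters and turns come from back-and-forth: the dual order, the set of points not
below a given point, and the turned order all satisfy the same one-point extension property as P. -/

namespace RandomPoset

/-- One-point extensions over finite sets: there is a point above `A`, below `B` and incomparable
to `C` whenever the order allows it. -/
def HasExtensions (P : Type*) [PartialOrder P] : Prop :=
  ∀ A B C : Finset P, (∀ a ∈ A, ∀ b ∈ B, a < b) → (∀ c ∈ C, ∀ a ∈ A, ¬ c ≤ a) →
    (∀ c ∈ C, ∀ b ∈ B, ¬ b ≤ c) →
    ∃ x, (∀ a ∈ A, a < x) ∧ (∀ b ∈ B, x < b) ∧ ∀ c ∈ C, Incomp c x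

/-! ### One-point extensions from universality and homogeneity -/

section Adjoin

variable {P : Type*} [PartialOrder P]

/-- The finite suborder `S` of `P` with a new point between `A` and `B`. -/
def AdjoinOn (A B : Finset P) (_ : ∀ a ∈ A, ∀ b ∈ B, a < b) (S : Finset P) : Type _ := Option S

/-- The order of `AdjoinOn A B h S`. -/
def adjoinLE (A B S : Finset P) : Option S → Option S → Prop
  | none, none => True
  | some x, some y => x ≤ y
  | some x, none => ∃ a ∈ A, x ≤ a
  | none, some y => ∃ b ∈ B, b ≤ y

/-- This is the weakest extension of the order that puts the new point between `A` and `B`. The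
hypothesis `h` makes a passage through the new point create no relation between old points. -/
instance (A B : Finset P) (h : ∀ a ∈ A, ∀ b ∈ B, a < b) (S : Finset P) :
    PartialOrder (AdjoinOn A B h S) where
  le := adjoinLE A B S
  le_refl x := by
    cases x with
    | none => trivial
    | some x => exact le_refl x
  le_trans x y z hxy hyz := by
    rcases x with _ | x <;> rcases y with _ | y <;> rcases z with _ | z
    · trivial
    · exact hyz
    · trivial
    · obtain ⟨b, hb, hby⟩ := hxy
      exact ⟨b, hb, hby.trans hyz⟩
    · exact hxy
    · obtain ⟨a, ha, hxa⟩ := hxy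
      obtain ⟨b, hb, hbz⟩ := hyz
      exact hxa.trans ((h a ha b hb).le.trans hbz)
    · obtain ⟨a, ha, hya⟩ := hyz
      exact ⟨a, ha, le_trans (α := P) hxy hya⟩
    · exact le_trans (α := S) hxy hyz
  le_antisymm x y hxy hyx := by
    rcases x with _ | x <;> rcases y with _ | y
    · rfl
    · obtain ⟨b, hb, hby⟩ := hxy
      obtain ⟨a, ha, hya⟩ := hyx
      exact absurd (h a ha b hb) (hby.trans hya).not_gt
    · obtain ⟨a, ha, hxa⟩ := hxy
      obtain ⟨b, hb, hbx⟩ := hyx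
      exact absurd (h a ha b hb) (hbx.trans hxa).not_gt
    · exact congrArg some (le_antisymm hxy hyx)

instance (A B : Finset P) (h : ∀ a ∈ A, ∀ b ∈ B, a < b) (S : Finset P) :
    Finite (AdjoinOn A B h S) :=
  inferInstanceAs (Finite (Option S))

/-- The new point. -/
def AdjoinOn.new (A B : Finset P) (h : ∀ a ∈ A, ∀ b ∈ B, a < b) (S : Finset P) :
    AdjoinOn A B h S := none

/-- The old points. -/
def AdjoinOn.old (A B : Finset P) (h : ∀ a ∈ A, ∀ b ∈ B, a < b) (S : Finset P) (x : S) :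
    AdjoinOn A B h S := some x

open Classical in
/-- An embedding of `AdjoinOn A B h S` that fixes the old points solves the extension problem. -/
theorem AdjoinOn.solution {A B C : Finset P} (h : ∀ a ∈ A, ∀ b ∈ B, a < b)
    (hA : ∀ c ∈ C, ∀ a ∈ A, ¬ c ≤ a) (hB : ∀ c ∈ C, ∀ b ∈ B, ¬ b ≤ c)
    (e : AdjoinOn A B h (A ∪ B ∪ C) ↪o P) (he : ∀ x, e (old A B h _ x) = x) :
    (∀ a ∈ A, a < e (new A B h _)) ∧ (∀ b ∈ B, e (new A B h _) < b) ∧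
      ∀ c ∈ C, Incomp c (e (new A B h _)) := by
  have h1 : ∀ x ∈ A ∪ B ∪ C, x ≤ e (new A B h _) ↔ ∃ a ∈ A, x ≤ a := fun x hx => by
    have := e.le_iff_le (a := old A B h _ ⟨x, hx⟩) (b := new A B h _)
    rw [he] at this
    exact this
  have h2 : ∀ x ∈ A ∪ B ∪ C, e (new A B h _) ≤ x ↔ ∃ b ∈ B, b ≤ x := fun x hx => by
    have := e.le_iff_le (a := new A B h _) (b := old A B h _ ⟨x, hx⟩)
    rw [he] at this
    exact this
  refine ⟨fun a ha => ?_, fun b hb => ?_, fun c hc => ⟨?_, ?_⟩⟩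
  · rw [lt_iff_le_not_ge, h1 a (by simp [ha]), h2 a (by simp [ha])]
    exact ⟨⟨a, ha, le_rfl⟩, fun ⟨b, hb, hba⟩ => (h a ha b hb).not_ge hba⟩
  · rw [lt_iff_le_not_ge, h1 b (by simp [hb]), h2 b (by simp [hb])]
    exact ⟨⟨b, hb, le_rfl⟩, fun ⟨a, ha, hba⟩ => (h a ha b hb).not_ge hba⟩
  · rw [h1 c (by simp [hc])]
    exact fun ⟨a, ha, hca⟩ => hA c hc a ha hca
  · rw [h2 c (by simp [hc])]
    exact fun ⟨b, hb, hbc⟩ => hB c hc b hb hbc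

/-- The order on `Q` carried over to an equivalent type. -/
theorem exists_model_type_zero (Q : Type*) [Finite Q] [PartialOrder Q] :
    ∃ (Q' : Type) (_ : Finite Q') (_ : PartialOrder Q'), Nonempty (Q ≃o Q') := by
  obtain ⟨n, ⟨e⟩⟩ := Finite.exists_equiv_fin Q
  refine ⟨Fin n, inferInstance, PartialOrder.lift e.symm e.symm.injective,
    ⟨@RelIso.mk _ _ _ (_) e fun {a b} => ?_⟩⟩
  change e.symm (e a) ≤ e.symm (e b) ↔ _
  simp

theorem IsRandomPoset.exists_embedding (hP : IsRandomPoset P) (Q : Type*) [Finite Q]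
    [PartialOrder Q] : Nonempty (Q ↪o P) := by
  obtain ⟨Q', _, _, ⟨e⟩⟩ := exists_model_type_zero Q
  obtain ⟨f⟩ := hP.universal Q'
  exact ⟨e.toOrderEmbedding.trans f⟩

theorem IsRandomFilter.exists_embedding {F : Set P} (hF : IsRandomFilter F) (Q : Type*) [Finite Q]
    [PartialOrder Q] {U : Set Q} (hU : IsUpperSet U) : ∃ e : Q ↪o P, ∀ q, e q ∈ F ↔ q ∈ U := by
  obtain ⟨Q', _, _, ⟨e⟩⟩ := exists_model_type_zero Q
  obtain ⟨f, hf⟩ := hF.universal Q' (e.symm ⁻¹' U) fun a b hab ha =>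
    hU (e.symm.monotone hab) ha
  refine ⟨e.toOrderEmbedding.trans f, fun q => ?_⟩
  change f (e q) ∈ F ↔ _
  rw [hf]; simp

-- Embed `Q` anywhere by universality, then use homogeneity to move the copy of `S` back onto `S`.
open Classical in
theorem IsRandomPoset.exists_embedding_fixing (hP : IsRandomPoset P) {Q : Type*} [Finite Q]
    [PartialOrder Q] (S : Finset P) (i : S → Q) (hi : ∀ x y, i x ≤ i y ↔ x ≤ y) :
    ∃ e : Q ↪o P, ∀ x, e (i x) = x := by
  obtain ⟨e⟩ := hP.exists_embedding Q
  obtain ⟨g, hg⟩ := hP.homogeneous S (fun x => if h : x ∈ S then e (i ⟨x, h⟩) else x)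
    fun x hx y hy => by simp [hx, hy, hi]
  refine ⟨e.trans g.symm.toOrderEmbedding, fun x => ?_⟩
  have := hg x x.2
  simp only [x.2, dif_pos] at this
  change g.symm (e (i x)) = x
  rw [← this, g.symm_apply_apply]

open Classical in
theorem IsRandomFilter.exists_embedding_fixing {F : Set P} (hF : IsRandomFilter F) {Q : Type*}
    [Finite Q] [PartialOrder Q] {U : Set Q} (hU : IsUpperSet U) (S : Finset P) (i : S → Q)
    (hi : ∀ x y, i x ≤ i y ↔ x ≤ y) (hiU : ∀ x, i x ∈ U ↔ x.1 ∈ F) :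
    ∃ e : Q ↪o P, (∀ x, e (i x) = x) ∧ ∀ q, e q ∈ F ↔ q ∈ U := by
  obtain ⟨e, he⟩ := hF.exists_embedding Q hU
  obtain ⟨g, hgF, hg⟩ := hF.homogeneous S (fun x => if h : x ∈ S then e (i ⟨x, h⟩) else x)
    (fun x hx y hy => by simp [hx, hy, hi]) (fun x hx => by simp [hx, he, hiU])
  refine ⟨e.trans g.symm.toOrderEmbedding, fun x => ?_, fun q => ?_⟩
  · have := hg x x.2
    simp only [x.2, dif_pos] at this
    change g.symm (e (i x)) = x
    rw [← this, g.symm_apply_apply]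
  · change g.symm (e q) ∈ F ↔ _
    rw [← hgF, g.apply_symm_apply, he]

theorem IsRandomPoset.hasExtensions (hP : IsRandomPoset P) : HasExtensions P := by
  classical
  intro A B C h hA hB
  obtain ⟨e, he⟩ := hP.exists_embedding_fixing (A ∪ B ∪ C) (AdjoinOn.old A B h _)
    fun x y => Iff.rfl
  exact ⟨_, AdjoinOn.solution h hA hB e he⟩

theorem IsRandomFilter.exists_extension {F : Set P} (hF : IsRandomFilter F) {A B C : Finset P}
    (h : ∀ a ∈ A, ∀ b ∈ B, a < b) (hA : ∀ c ∈ C, ∀ a ∈ A, ¬ c ≤ a)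
    (hB : ∀ c ∈ C, ∀ b ∈ B, ¬ b ≤ c) (p : Prop) (hpB : p → ∀ b ∈ B, b ∈ F)
    (hpA : ¬ p → ∀ a ∈ A, a ∉ F) :
    ∃ x, (x ∈ F ↔ p) ∧ (∀ a ∈ A, a < x) ∧ (∀ b ∈ B, x < b) ∧ ∀ c ∈ C, Incomp c x := by
  classical
  let U : Set (AdjoinOn A B h (A ∪ B ∪ C)) := fun o => Option.elim o p fun x => x.1 ∈ F
  have hU : IsUpperSet U := by
    rintro (_ | x) (_ | y) hxy hxU
    · exact hxU
    · obtain ⟨b, hb, hby⟩ := hxy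
      exact hF.upper hby (hpB hxU b hb)
    · obtain ⟨a, ha, hxa⟩ := hxy
      by_contra hp
      exact hpA hp a ha (hF.upper hxa hxU)
    · exact hF.upper (a := x) (b := y) hxy hxU
  obtain ⟨e, he, heU⟩ := hF.exists_embedding_fixing hU (A ∪ B ∪ C) (AdjoinOn.old A B h _)
    (fun x y => Iff.rfl) (fun x => Iff.rfl)
  exact ⟨_, heU _, AdjoinOn.solution h hA hB e he⟩

end Adjoin

/-! ### Back-and-forth -/

section BackAndForth

variable {P Q : Type*} [PartialOrder P] [PartialOrder Q]

/-- Finite partial isomorphisms, as finite sets of pairs. -/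
abbrev FinPartialIso (P Q : Type*) [PartialOrder P] [PartialOrder Q] : Type _ :=
  {f : Finset (P × Q) // ∀ p ∈ f, ∀ q ∈ f, p.1 ≤ q.1 ↔ p.2 ≤ q.2}

open Classical in
theorem FinPartialIso.exists_left (hQ : HasExtensions Q) (f : FinPartialIso P Q) (a : P) :
    ∃ g, f ≤ g ∧ ∃ b, (a, b) ∈ g.1 := by
  by_cases ha : ∃ b, (a, b) ∈ f.1
  · exact ⟨f, le_rfl, ha⟩
  have hne : ∀ p ∈ f.1, p.1 ≠ a := fun p hp e => ha ⟨p.2, e ▸ hp⟩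
  obtain ⟨b, h1, h2, h3⟩ := hQ ((f.1.filter fun p => p.1 ≤ a).image Prod.snd)
    ((f.1.filter fun p => a ≤ p.1).image Prod.snd)
    ((f.1.filter fun p => Incomp p.1 a).image Prod.snd)
    (by
      simp only [Finset.mem_image, Finset.mem_filter]
      rintro _ ⟨p, ⟨hp, hpa⟩, rfl⟩ _ ⟨q, ⟨hq, haq⟩, rfl⟩
      refine lt_of_le_not_ge ((f.2 p hp q hq).1 (hpa.trans haq)) fun h => hne p hp ?_
      exact hpa.antisymm (haq.trans ((f.2 q hq p hp).2 h)))
    (by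
      simp only [Finset.mem_image, Finset.mem_filter]
      rintro _ ⟨p, ⟨hp, hpa⟩, rfl⟩ _ ⟨q, ⟨hq, haq⟩, rfl⟩ h
      exact hpa.1 (((f.2 p hp q hq).2 h).trans haq))
    (by
      simp only [Finset.mem_image, Finset.mem_filter]
      rintro _ ⟨p, ⟨hp, hpa⟩, rfl⟩ _ ⟨q, ⟨hq, haq⟩, rfl⟩ h
      exact hpa.2 (haq.trans ((f.2 q hq p hp).2 h)))
  simp only [Finset.mem_image, Finset.mem_filter, forall_exists_index, and_imp] at h1 h2 h3
  have key : ∀ p ∈ f.1, (p.1 ≤ a ↔ p.2 ≤ b) ∧ (a ≤ p.1 ↔ b ≤ p.2) := by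
    intro p hp
    have e1 := h1 p.2 p hp
    have e2 := h2 p.2 p hp
    have e3 := h3 p.2 p hp
    by_cases hpa : p.1 ≤ a
    · have := e1 hpa rfl
      have h' : ¬ a ≤ p.1 := fun h => hne p hp (hpa.antisymm h)
      simp [hpa, h', this.le, this.not_ge]
    · by_cases hap : a ≤ p.1
      · have := e2 hap rfl
        simp [hpa, hap, this.le, this.not_ge]
      · have := e3 ⟨hpa, hap⟩ rfl
        simp [hpa, hap, this.1, this.2]
  refine ⟨⟨insert (a, b) f.1, ?_⟩, Finset.subset_insert _ _, b, Finset.mem_insert_self _ _⟩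
  intro p hp q hq
  rcases Finset.mem_insert.1 hp with rfl | hp <;> rcases Finset.mem_insert.1 hq with rfl | hq
  · simp
  · exact (key q hq).2
  · exact (key p hp).1
  · exact f.2 p hp q hq

open Classical in
/-- The inverse partial isomorphism. -/
noncomputable def FinPartialIso.swap (f : FinPartialIso P Q) : FinPartialIso Q P :=
  ⟨f.1.image Prod.swap, by
    simp only [Finset.mem_image]
    rintro _ ⟨p, hp, rfl⟩ _ ⟨q, hq, rfl⟩
    exact (f.2 p hp q hq).symm⟩

theorem FinPartialIso.mem_swap {f : FinPartialIso P Q} {a : P} {b : Q} :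
    (b, a) ∈ f.swap.1 ↔ (a, b) ∈ f.1 := by
  simp [FinPartialIso.swap]

theorem FinPartialIso.exists_right (hP : HasExtensions P) (f : FinPartialIso P Q) (b : Q) :
    ∃ g, f ≤ g ∧ ∃ a, (a, b) ∈ g.1 := by
  obtain ⟨g, hg, a, ha⟩ := f.swap.exists_left hP b
  exact ⟨g.swap, fun p hp => mem_swap.2 (hg (mem_swap.2 hp)), a, mem_swap.2 ha⟩

/-- Countable partial orders with one-point extensions are isomorphic. -/
theorem HasExtensions.nonempty_orderIso [Countable P] [Countable Q] (hP : HasExtensions P)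
    (hQ : HasExtensions Q) : Nonempty (P ≃o Q) := by
  let D : P ⊕ Q → Order.Cofinal (FinPartialIso P Q) := Sum.elim
    (fun a => ⟨{f | ∃ b, (a, b) ∈ f.1}, fun f =>
      let ⟨g, hg, h⟩ := f.exists_left hQ a; ⟨g, h, hg⟩⟩)
    (fun b => ⟨{f | ∃ a, (a, b) ∈ f.1}, fun f =>
      let ⟨g, hg, h⟩ := f.exists_right hP b; ⟨g, h, hg⟩⟩)
  have := Encodable.ofCountable (P ⊕ Q)
  -- A directed family of finite partial isomorphisms that meets every domain and range requirement.
  -- Directedness makes any two of its pairs order-compatible, which also gives that the two choice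
  -- functions are inverse to each other.
  let I := Order.idealOfCofinals ⟨∅, by simp⟩ D
  have hl : ∀ a, ∃ b, ∃ f ∈ I, (a, b) ∈ f.1 := fun a => by
    obtain ⟨f, ⟨b, hb⟩, hf⟩ := Order.cofinal_meets_idealOfCofinals ⟨∅, by simp⟩ D (Sum.inl a)
    exact ⟨b, f, hf, hb⟩
  have hr : ∀ b, ∃ a, ∃ f ∈ I, (a, b) ∈ f.1 := fun b => by
    obtain ⟨f, ⟨a, ha⟩, hf⟩ := Order.cofinal_meets_idealOfCofinals ⟨∅, by simp⟩ D (Sum.inr b)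
    exact ⟨a, f, hf, ha⟩
  choose φ hφ using hl
  choose ψ hψ using hr
  have compat : ∀ {a b a' b'}, (∃ f ∈ I, (a, b) ∈ f.1) → (∃ f ∈ I, (a', b') ∈ f.1) →
      (a ≤ a' ↔ b ≤ b') := by
    rintro a b a' b' ⟨f, hf, hab⟩ ⟨g, hg, hab'⟩
    obtain ⟨m, -, hfm, hgm⟩ := I.directed f hf g hg
    exact m.2 _ (hfm hab) _ (hgm hab')
  exact ⟨{
    toFun := φ
    invFun := ψ
    left_inv := fun a => le_antisymm ((compat (hψ (φ a)) (hφ a)).2 le_rfl)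
      ((compat (hφ a) (hψ (φ a))).2 le_rfl)
    right_inv := fun b => le_antisymm ((compat (hφ (ψ b)) (hψ b)).1 le_rfl)
      ((compat (hψ b) (hφ (ψ b))).1 le_rfl)
    map_rel_iff' := fun {a b} => (compat (hφ a) (hφ b)).symm }⟩

end BackAndForth

/-! ### Existence of reversals, random filters and turns -/

section Existence

variable {P : Type*} [PartialOrder P]

theorem HasExtensions.dual (hP : HasExtensions P) : HasExtensions Pᵒᵈ := by
  intro A B C h hA hB
  obtain ⟨x, h1, h2, h3⟩ := @hP B A C (fun b hb a ha => h a ha b hb) hB hA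
  exact ⟨x, h2, h1, fun c hc => ⟨(h3 c hc).2, (h3 c hc).1⟩⟩

theorem HasExtensions.exists_isReversal [Countable P] (hP : HasExtensions P) :
    ∃ r : Equiv.Perm P, IsReversal r := by
  have : Countable Pᵒᵈ := inferInstanceAs (Countable P)
  obtain ⟨φ⟩ := hP.nonempty_orderIso hP.dual
  exact ⟨φ.toEquiv.trans OrderDual.ofDual, fun a b => φ.le_iff_le (x := b) (y := a)⟩

/-- The points that are not below `p`. -/
abbrev NotBelow (p : P) : Type _ := {x : P // ¬ x ≤ p}

/-- The extra demand is that the new point avoid the down-set of `p`. This is automatic if some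
member of `A` lies above `p`; otherwise `p` can be added to the points required to be incomparable.
-/
theorem HasExtensions.notBelow (hP : HasExtensions P) (p : P) : HasExtensions (NotBelow p) := by
  classical
  intro A B C h hA hB
  let A' := A.map (Function.Embedding.subtype _)
  let B' := B.map (Function.Embedding.subtype _)
  let C' := C.map (Function.Embedding.subtype _)
  have h' : ∀ a ∈ A', ∀ b ∈ B', a < b := by
    simp only [A', B', Finset.mem_map]
    rintro _ ⟨a, ha, rfl⟩ _ ⟨b, hb, rfl⟩
    exact h a ha b hb
  have hA' : ∀ c ∈ C', ∀ a ∈ A', ¬ c ≤ a := by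
    simp only [A', C', Finset.mem_map]
    rintro _ ⟨c, hc, rfl⟩ _ ⟨a, ha, rfl⟩
    exact hA c hc a ha
  have hB' : ∀ c ∈ C', ∀ b ∈ B', ¬ b ≤ c := by
    simp only [B', C', Finset.mem_map]
    rintro _ ⟨c, hc, rfl⟩ _ ⟨b, hb, rfl⟩
    exact hB c hc b hb
  have hX : ∀ T : Finset (NotBelow p), ∀ x ∈ T.map (Function.Embedding.subtype _), ¬ x ≤ p := by
    intro T x hx
    obtain ⟨y, -, rfl⟩ := Finset.mem_map.1 hx
    exact y.2
  have main : ∃ x, ¬ x ≤ p ∧ (∀ a ∈ A', a < x) ∧ (∀ b ∈ B', x < b) ∧ ∀ c ∈ C', Incomp c x := by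
    by_cases hp : ∃ a ∈ A', p < a
    · obtain ⟨a, ha, hpa⟩ := hp
      obtain ⟨x, h1, h2, h3⟩ := hP A' B' C' h' hA' hB'
      exact ⟨x, (hpa.trans (h1 a ha)).not_ge, h1, h2, h3⟩
    · push Not at hp
      obtain ⟨x, h1, h2, h3⟩ := hP A' B' (insert p C') h'
        (by
          intro c hc a ha
          rcases Finset.mem_insert.1 hc with rfl | hc
          · exact fun hca => hp a ha (lt_of_le_of_ne hca fun e => hX A a ha e.ge)
          · exact hA' c hc a ha)
        (by
          intro c hc b hb
          rcases Finset.mem_insert.1 hc with rfl | hc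
          · exact hX B b hb
          · exact hB' c hc b hb)
      exact ⟨x, (h3 p (Finset.mem_insert_self _ _)).2, h1, h2,
        fun c hc => h3 c (Finset.mem_insert_of_mem hc)⟩
  obtain ⟨x, hx, h1, h2, h3⟩ := main
  exact ⟨⟨x, hx⟩, fun a ha => h1 a (Finset.mem_map_of_mem _ ha),
    fun b hb => h2 b (Finset.mem_map_of_mem _ hb), fun c hc => h3 c (Finset.mem_map_of_mem _ hc)⟩

/-- `Q` with a new point whose strict upper bounds are the members of `U`. -/
def AdjoinBelow {Q : Type*} [PartialOrder Q] (U : Set Q) (_ : IsUpperSet U) : Type _ := Option Q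

/-- The order of `AdjoinBelow U hU`. -/
def adjoinBelowLE {Q : Type*} [PartialOrder Q] (U : Set Q) : Option Q → Option Q → Prop
  | none, none => True
  | some x, some y => x ≤ y
  | some _, none => False
  | none, some y => y ∈ U

instance {Q : Type*} [PartialOrder Q] (U : Set Q) (hU : IsUpperSet U) :
    PartialOrder (AdjoinBelow U hU) where
  le := adjoinBelowLE U
  le_refl x := by
    cases x with
    | none => trivial
    | some x => exact le_refl x
  le_trans x y z hxy hyz := by
    rcases x with _ | x <;> rcases y with _ | y <;> rcases z with _ | z
    · trivial
    · exact hyz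
    · trivial
    · exact hU hyz hxy
    · exact hxy
    · exact hxy.elim
    · exact hyz
    · exact le_trans (α := Q) hxy hyz
  le_antisymm x y hxy hyx := by
    rcases x with _ | x <;> rcases y with _ | y
    · rfl
    · exact hyx.elim
    · exact hxy.elim
    · exact congrArg some (le_antisymm hxy hyx)

instance {Q : Type*} [PartialOrder Q] [Finite Q] (U : Set Q) (hU : IsUpperSet U) :
    Finite (AdjoinBelow U hU) :=
  inferInstanceAs (Finite (Option Q))

/-- The new point. -/
def AdjoinBelow.new {Q : Type*} [PartialOrder Q] (U : Set Q) (hU : IsUpperSet U) :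
    AdjoinBelow U hU := none

/-- The old points. -/
def AdjoinBelow.old {Q : Type*} [PartialOrder Q] (U : Set Q) (hU : IsUpperSet U) (q : Q) :
    AdjoinBelow U hU := some q

/-- A map between finite suborders that fixes a point `p` extends to an automorphism. -/
theorem IsRandomPoset.homogeneous_fixing (hP : IsRandomPoset P) (p : P) (S : Finset P) (f : P → P)
    (hf : ∀ x ∈ S, ∀ y ∈ S, f x ≤ f y ↔ x ≤ y) (hp : ∀ x ∈ S, f x ≤ p ↔ x ≤ p)
    (hp' : ∀ x ∈ S, p ≤ f x ↔ p ≤ x) :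
    ∃ g : P ≃o P, g p = p ∧ ∀ x ∈ S, g x = f x := by
  classical
  have hfix : p ∈ S → f p = p := fun h => le_antisymm ((hp p h).2 le_rfl) ((hp' p h).2 le_rfl)
  have hne : ∀ x ∈ S, (if x = p then p else f x) = f x := by
    intro x hx
    split_ifs with h
    · subst h; exact (hfix hx).symm
    · rfl
  obtain ⟨g, hg⟩ := hP.homogeneous (insert p S) (fun x => if x = p then p else f x) (by
    intro x hx y hy
    rcases Finset.mem_insert.1 hx with hx | hx <;> rcases Finset.mem_insert.1 hy with hy | hy
    · simp [hx, hy]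
    · simp only [hne y hy, hx, if_true]; exact hp' y hy
    · simp only [hne x hx, hy, if_true]; exact hp x hx
    · simp only [hne x hx, hne y hy]; exact hf x hx y hy)
  refine ⟨g, by simpa using hg p (Finset.mem_insert_self _ _), fun x hx => ?_⟩
  rw [hg x (Finset.mem_insert_of_mem hx), hne x hx]

/-- The points not below a fixed `p` form a copy of P, in which those above `p` form the filter.
Finite orders with an upper set `U` then correspond to finite orders with an extra point that is
below exactly `U` and above nothing else, so universality and homogeneity are inherited from P with
`p` fixed. -/
theorem IsRandomPoset.exists_isRandomFilter (hP : IsRandomPoset P) :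
    ∃ F : Set P, IsRandomFilter F := by
  classical
  have := hP.countable
  obtain ⟨p, -⟩ := hP.hasExtensions ∅ ∅ ∅ (by simp) (by simp) (by simp)
  obtain ⟨φ⟩ := (hP.hasExtensions.notBelow p).nonempty_orderIso hP.hasExtensions
  refine ⟨{x | p ≤ φ.symm x}, fun a b hab ha => le_trans (α := P) ha (φ.symm.monotone hab), ?_, ?_⟩
  · intro Q _ _ U hU
    obtain ⟨e⟩ := hP.exists_embedding (AdjoinBelow U hU)
    obtain ⟨g, hg⟩ := hP.homogeneous {e (.new U hU)} (fun _ => p) (by simp)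
    have hgp : g (e (.new U hU)) = p := hg _ (by simp)
    have h0 : ∀ q q', g (e q) ≤ g (e q') ↔ q ≤ q' := fun q q' =>
      g.le_iff_le.trans e.le_iff_le
    have h1 : ∀ q : Q, ¬ g (e (.old U hU q)) ≤ p := fun q => by
      rw [← hgp, h0]; exact id
    have h2 : ∀ q : Q, p ≤ g (e (.old U hU q)) ↔ q ∈ U := fun q => by
      rw [← hgp, h0]; rfl
    refine ⟨OrderEmbedding.ofMapLEIff (fun q => φ ⟨g (e (.old U hU q)), h1 q⟩) fun q q' => ?_,
      fun q => ?_⟩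
    · rw [φ.le_iff_le, Subtype.mk_le_mk, h0]; rfl
    · change p ≤ (φ.symm (φ _)).1 ↔ _
      rw [φ.symm_apply_apply]; exact h2 q
  · intro S f hf hfF
    obtain ⟨g, hgp, hg⟩ := hP.homogeneous_fixing p (S.image fun x => (φ.symm x).1)
      -- The value for `x ≤ p` is a dummy: no point of the transported finite set lies below `p`.
      (fun x => if h : x ≤ p then x else (φ.symm (f (φ ⟨x, h⟩))).1)
      (by
        simp only [Finset.mem_image]
        rintro _ ⟨x, hx, rfl⟩ _ ⟨y, hy, rfl⟩
        simp only [(φ.symm x).2, (φ.symm y).2, dif_neg, not_false_eq_true, Subtype.coe_eta,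
          φ.apply_symm_apply, Subtype.coe_le_coe, φ.symm.le_iff_le]
        exact hf x hx y hy)
      (by
        simp only [Finset.mem_image]
        rintro _ ⟨x, hx, rfl⟩
        simp only [(φ.symm x).2, dif_neg, not_false_eq_true, (φ.symm _).2])
      (by
        simp only [Finset.mem_image]
        rintro _ ⟨x, hx, rfl⟩
        simp only [(φ.symm x).2, dif_neg, not_false_eq_true, Subtype.coe_eta, φ.apply_symm_apply]
        exact hfF x hx)
    let g' : NotBelow p ≃o NotBelow p :=
      { toEquiv := g.toEquiv.subtypeEquiv fun x => by
          change ¬ x ≤ p ↔ ¬ g x ≤ p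
          rw [← g.le_iff_le (x := x), hgp]
        map_rel_iff' := fun {a b} => g.le_iff_le }
    have hg' : ∀ x, (g' x).1 = g x.1 := fun x => rfl
    refine ⟨φ.symm.trans (g'.trans φ), fun x => ?_, fun x hx => ?_⟩
    · change p ≤ (φ.symm (φ (g' (φ.symm x)))).1 ↔ p ≤ (φ.symm x).1
      rw [φ.symm_apply_apply, hg']
      exact (iff_of_eq (by rw [hgp])).trans (g.le_iff_le (x := p))
    · change φ (g' (φ.symm x)) = f x
      rw [← φ.symm.injective.eq_iff, φ.symm_apply_apply]
      apply Subtype.ext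
      rw [hg', hg _ (Finset.mem_image_of_mem _ hx)]
      simp only [(φ.symm x).2, dif_neg, not_false_eq_true, Subtype.coe_eta, φ.apply_symm_apply]

/-- The type `P` with the order turned around `F`. -/
def Turned (_ : UpperSet P) : Type _ := P

/-- The strict order of `Turned F`. -/
def TurnedLT (F : Set P) (x y : P) : Prop :=
  ((x ∈ F ↔ y ∈ F) ∧ x < y) ∨ (x ∈ F ∧ y ∉ F ∧ Incomp x y)

theorem turnedLT_of_iff {F : Set P} {x y : P} (h : x ∈ F ↔ y ∈ F) : TurnedLT F x y ↔ x < y := by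
  unfold TurnedLT
  tauto

theorem turnedLT_of_mem {F : Set P} {x y : P} (hx : x ∈ F) (hy : y ∉ F) :
    TurnedLT F x y ↔ Incomp x y := by
  unfold TurnedLT
  tauto

theorem not_turnedLT {F : Set P} {x y : P} (hx : x ∉ F) (hy : y ∈ F) : ¬ TurnedLT F x y := by
  unfold TurnedLT
  tauto

theorem lt_of_not_turnedLT {F : Set P} (hF : IsUpperSet F) {x y : P} (hx : x ∈ F) (hy : y ∉ F)
    (h : ¬ TurnedLT F x y) : y < x := by
  have h1 : ¬ x ≤ y := fun h => hy (hF h hx)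
  rw [turnedLT_of_mem hx hy, Incomp, not_and_or, not_not, not_not] at h
  exact lt_of_le_not_ge (h.resolve_left h1) h1

theorem isStrictOrder_turnedLT {F : Set P} (hF : IsUpperSet F) :
    IsStrictOrder P (TurnedLT F) where
  irrefl x := by simp [turnedLT_of_iff]
  trans x y z := by
    rintro (⟨hxy, h⟩ | ⟨hx, hy, h⟩) (⟨hyz, h'⟩ | ⟨hy', hz, h'⟩)
    · exact Or.inl ⟨hxy.trans hyz, h.trans h'⟩
    · exact Or.inr ⟨hxy.2 hy', hz, fun hxz => hz (hF hxz (hxy.2 hy')),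
        fun hzx => h'.2 (hzx.trans h.le)⟩
    · exact Or.inr ⟨hx, fun hz => hy (hyz.2 hz), fun hxz => hy (hyz.2 (hF hxz hx)),
        fun hzx => h.2 (h'.le.trans hzx)⟩
    · exact absurd hy' hy

instance (F : UpperSet P) : PartialOrder (Turned F) :=
  @partialOrderOfSO P (TurnedLT (F : Set P)) (isStrictOrder_turnedLT F.upper)

/-- Once it is decided whether the new point lies in `F`, each turned requirement becomes an
ordinary one. Across the boundary of `F`, comparability and incomparability change roles, so some
points of `A` or `B` become incomparability constraints and some points of `C` become bounds. -/
theorem IsRandomFilter.exists_turned_extension {F : Set P} (hF : IsRandomFilter F)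
    (A B C : Finset P) (h : ∀ a ∈ A, ∀ b ∈ B, TurnedLT F a b)
    (hA : ∀ c ∈ C, ∀ a ∈ A, ¬ (c = a ∨ TurnedLT F c a))
    (hB : ∀ c ∈ C, ∀ b ∈ B, ¬ (b = c ∨ TurnedLT F b c)) :
    ∃ x, (∀ a ∈ A, TurnedLT F a x) ∧ (∀ b ∈ B, TurnedLT F x b) ∧
      ∀ c ∈ C, ¬ (c = x ∨ TurnedLT F c x) ∧ ¬ (x = c ∨ TurnedLT F x c) := by
  classical
  simp only [not_or] at hA hB ⊢
  have same : ∀ {x y}, (x ∈ F ↔ y ∈ F) → (TurnedLT F x y ↔ x < y) := turnedLT_of_iff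
  have le_of_same : ∀ {x y}, (x ∈ F ↔ y ∈ F) → x ≠ y → ¬ TurnedLT F x y → ¬ x ≤ y :=
    fun h hne hlt hle => hlt ((same h).2 (lt_of_le_of_ne hle hne))
  have up : ∀ {x y}, x ∈ F → y ∉ F → ¬ x ≤ y := fun hx hy hxy => hy (hF.upper hxy hx)
  -- In the turned order the complement of `F` is upward closed. So the new point may be put outside
  -- `F` if `B` misses `F`; otherwise `A` lies inside `F` and the new point may be put there too.
  by_cases hBF : ∀ b ∈ B, b ∉ F
  · obtain ⟨x, hxF, h1, h2, h3⟩ := hF.exists_extension (A := A.filter (· ∉ F))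
      (B := B ∪ C.filter (· ∈ F)) (C := A.filter (· ∈ F) ∪ C.filter (· ∉ F))
      (by
        simp only [Finset.mem_filter, Finset.mem_union]
        rintro a ⟨ha, haF⟩ b (hb | ⟨hb, hbF⟩)
        · exact (same (by simp [haF, hBF b hb])).1 (h a ha b hb)
        · exact lt_of_not_turnedLT hF.upper hbF haF (hA b hb a ha).2)
      (by
        simp only [Finset.mem_filter, Finset.mem_union]
        rintro c (⟨hc, hcF⟩ | ⟨hc, hcF⟩) a ⟨ha, haF⟩
        · exact up hcF haF
        · exact le_of_same (by simp [haF, hcF]) (hA c hc a ha).1 (hA c hc a ha).2)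
      (by
        simp only [Finset.mem_filter, Finset.mem_union]
        rintro c (⟨hc, hcF⟩ | ⟨hc, hcF⟩) b (hb | ⟨hb, hbF⟩)
        · exact ((turnedLT_of_mem hcF (hBF b hb)).1 (h c hc b hb)).2
        · exact le_of_same (by simp [hbF, hcF]) (hA b hb c hc).1 (hA b hb c hc).2
        · exact le_of_same (by simp [hBF b hb, hcF]) (hB c hc b hb).1 (hB c hc b hb).2
        · exact up hbF hcF)
      False (by simp) (by simp)
    rw [iff_false] at hxF
    simp only [Finset.mem_filter, Finset.mem_union] at h1 h2 h3
    refine ⟨x, fun a ha => ?_, fun b hb => ?_, fun c hc => ?_⟩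
    · by_cases haF : a ∈ F
      · exact (turnedLT_of_mem haF hxF).2 (h3 a (Or.inl ⟨ha, haF⟩))
      · exact (same (by simp [haF, hxF])).2 (h1 a ⟨ha, haF⟩)
    · exact (same (by simp [hBF b hb, hxF])).2 (h2 b (Or.inl hb))
    · by_cases hcF : c ∈ F
      · have hxc := h2 c (Or.inr ⟨hc, hcF⟩)
        rw [turnedLT_of_mem hcF hxF]
        exact ⟨⟨hxc.ne', fun h => h.2 hxc.le⟩, hxc.ne, not_turnedLT hxF hcF⟩
      · have hxc := h3 c (Or.inr ⟨hc, hcF⟩)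
        rw [same (by simp [hcF, hxF]), same (by simp [hcF, hxF])]
        exact ⟨⟨fun h => hxc.1 h.le, fun h => hxc.1 h.le⟩, fun h => hxc.2 h.le,
          fun h => hxc.2 h.le⟩
  · push Not at hBF
    obtain ⟨b₀, hb₀, hb₀F⟩ := hBF
    have hAF : ∀ a ∈ A, a ∈ F := fun a ha => by
      by_contra haF
      exact not_turnedLT haF hb₀F (h a ha b₀ hb₀)
    obtain ⟨x, hxF, h1, h2, h3⟩ := hF.exists_extension (A := A ∪ C.filter (· ∉ F))
      (B := B.filter (· ∈ F)) (C := B.filter (· ∉ F) ∪ C.filter (· ∈ F))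
      (by
        simp only [Finset.mem_filter, Finset.mem_union]
        rintro a (ha | ⟨ha, haF⟩) b ⟨hb, hbF⟩
        · exact (same (by simp [hbF, hAF a ha])).1 (h a ha b hb)
        · exact lt_of_not_turnedLT hF.upper hbF haF (hB a ha b hb).2)
      (by
        simp only [Finset.mem_filter, Finset.mem_union]
        rintro c (⟨hc, hcF⟩ | ⟨hc, hcF⟩) a (ha | ⟨ha, haF⟩)
        · exact ((turnedLT_of_mem (hAF a ha) hcF).1 (h a ha c hc)).2
        · exact le_of_same (by simp [haF, hcF]) (hB a ha c hc).1 (hB a ha c hc).2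
        · exact le_of_same (by simp [hAF a ha, hcF]) (hA c hc a ha).1 (hA c hc a ha).2
        · exact up hcF haF)
      (by
        simp only [Finset.mem_filter, Finset.mem_union]
        rintro c (⟨hc, hcF⟩ | ⟨hc, hcF⟩) b ⟨hb, hbF⟩
        · exact up hbF hcF
        · exact le_of_same (by simp [hbF, hcF]) (hB c hc b hb).1 (hB c hc b hb).2)
      True (by simp) (by simp)
    rw [iff_true] at hxF
    simp only [Finset.mem_filter, Finset.mem_union] at h1 h2 h3
    refine ⟨x, fun a ha => ?_, fun b hb => ?_, fun c hc => ?_⟩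
    · exact (same (by simp [hAF a ha, hxF])).2 (h1 a (Or.inl ha))
    · by_cases hbF : b ∈ F
      · exact (same (by simp [hbF, hxF])).2 (h2 b ⟨hb, hbF⟩)
      · have := h3 b (Or.inl ⟨hb, hbF⟩)
        exact (turnedLT_of_mem hxF hbF).2 ⟨this.2, this.1⟩
    · by_cases hcF : c ∈ F
      · have hxc := h3 c (Or.inr ⟨hc, hcF⟩)
        rw [same (by simp [hcF, hxF]), same (by simp [hcF, hxF])]
        exact ⟨⟨fun h => hxc.1 h.le, fun h => hxc.1 h.le⟩, fun h => hxc.2 h.le,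
          fun h => hxc.2 h.le⟩
      · have hxc := h1 c (Or.inr ⟨hc, hcF⟩)
        rw [turnedLT_of_mem hxF hcF]
        exact ⟨⟨hxc.ne, not_turnedLT hcF hxF⟩, hxc.ne', fun h => h.2 hxc.le⟩

theorem IsRandomFilter.hasExtensions_turned {F : UpperSet P} (hF : IsRandomFilter (F : Set P)) :
    HasExtensions (Turned F) :=
  fun A B C h hA hB => hF.exists_turned_extension A B C h hA hB

theorem IsRandomFilter.exists_isTurn [Countable P] (hP : HasExtensions P) {F : Set P}
    (hF : IsRandomFilter F) : ∃ t : Equiv.Perm P, IsTurn F t := by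
  let F' : UpperSet P := ⟨F, hF.upper⟩
  have : Countable (Turned F') := inferInstanceAs (Countable P)
  obtain ⟨φ⟩ := (IsRandomFilter.hasExtensions_turned (F := F') hF).nonempty_orderIso hP
  exact ⟨φ.toEquiv, fun x y => φ.lt_iff_lt (α := Turned F') (x := x) (y := y)⟩

end Existence

/-! ### The order as a sign cochain and its coboundary -/

section Sign

variable {P : Type*} [PartialOrder P]

open Classical in
/-- `1` if `a < b`, `-1` if `b < a` and `0` otherwise. -/
noncomputable def cmpSign (a b : P) : ℤ :=
  if a < b then 1 else if b < a then -1 else 0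

/-- The coboundary of `cmpSign`. -/
noncomputable def triSign (a b c : P) : ℤ :=
  cmpSign a b + cmpSign b c + cmpSign c a

open Classical in
theorem cmpSign_eq_ite (a b : P) : cmpSign a b =
    if a ≤ b ∧ ¬ b ≤ a then 1 else if b ≤ a ∧ ¬ a ≤ b then -1 else 0 := by
  unfold cmpSign
  rw [if_congr lt_iff_le_not_ge rfl rfl, if_congr (lt_iff_le_not_ge (a := b)) rfl rfl]

theorem cmpSign_congr {Q : Type*} [PartialOrder Q] {a b : P} {c d : Q} (h₁ : a < b ↔ c < d)
    (h₂ : b < a ↔ d < c) : cmpSign a b = cmpSign c d :=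
  by unfold cmpSign; grind

theorem cmpSign_eq_one {a b : P} : cmpSign a b = 1 ↔ a < b := by
  unfold cmpSign; split_ifs <;> simp_all

theorem cmpSign_eq_neg_one {a b : P} : cmpSign a b = -1 ↔ b < a := by
  unfold cmpSign
  split_ifs with h h'
  · simpa using h.not_gt
  · simpa using h'
  · simpa using h'

theorem cmpSign_swap (a b : P) : cmpSign a b = -cmpSign b a := by
  have := lt_asymm (a := a) (b := b)
  unfold cmpSign
  grind

@[simp] theorem cmpSign_self (a : P) : cmpSign a a = 0 := by simp [cmpSign]

theorem cmpSign_eq_zero {a b : P} : cmpSign a b = 0 ↔ a = b ∨ Incomp a b := by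
  have := le_antisymm_iff (a := a) (b := b)
  simp only [cmpSign_eq_ite, Incomp]
  grind

theorem Incomp.cmpSign_eq {a b : P} (h : Incomp a b) : cmpSign a b = 0 :=
  cmpSign_eq_zero.2 (Or.inr h)

theorem cmpSign_mem (a b : P) : -1 ≤ cmpSign a b ∧ cmpSign a b ≤ 1 := by
  unfold cmpSign; split_ifs <;> simp

theorem Incomp.symm {a b : P} (h : Incomp a b) : Incomp b a := ⟨h.2, h.1⟩

theorem Incomp.ne {a b : P} (h : Incomp a b) : a ≠ b := fun e => h.1 e.le

/-- Two terms of the same nonzero sign form a chain, and transitivity forces the third term to have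
the opposite sign. -/
theorem triSign_mem (a b c : P) : -1 ≤ triSign a b c ∧ triSign a b c ≤ 1 := by
  unfold triSign cmpSign
  grind

theorem cyc_iff_triSign (a b c : P) : Cyc a b c ↔ triSign a b c = 1 := by
  simp only [Cyc, triSign, cmpSign_eq_ite, Incomp, lt_iff_le_not_ge]
  grind

theorem pari_iff_triSign (a b c : P) :
    Pari a b c ↔ triSign a b c = 0 ∧ a ≠ b ∧ b ≠ c ∧ c ≠ a := by
  simp only [Pari, triSign, cmpSign_eq_ite, Incomp, lt_iff_le_not_ge, ne_eq, le_antisymm_iff]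
  grind

theorem triSign_rotate (a b c : P) : triSign a b c = triSign b c a := by
  unfold triSign; ring

theorem triSign_swap (a b c : P) : triSign a b c = -triSign b a c := by
  unfold triSign
  rw [cmpSign_swap a b, cmpSign_swap b c, cmpSign_swap c a]; ring

theorem triSign_self (a b : P) : triSign a a b = 0 := by
  unfold triSign
  rw [cmpSign_swap b a]; simp

theorem triSign_cocycle (a b c e : P) :
    triSign b c e - triSign a c e + triSign a b e - triSign a b c = 0 := by
  unfold triSign
  rw [cmpSign_swap e a, cmpSign_swap c a, cmpSign_swap e b]; ring

theorem le_iff_of_cmpSign_eq {Q : Type*} [PartialOrder Q] {a b : P} {a' b' : Q}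
    (h : cmpSign a b = cmpSign a' b') (he : a = b ↔ a' = b') : a ≤ b ↔ a' ≤ b' := by
  rw [le_iff_lt_or_eq, le_iff_lt_or_eq, ← cmpSign_eq_one, ← cmpSign_eq_one, h, he]

-- For `x ∈ F` and `y ∉ F` upward closure leaves only `y < x` or incomparability, that is, sign -1
-- or 0; the turn raises these to 0 and 1. Inside `F` and inside its complement nothing changes.
open Classical in
theorem IsTurn.cmpSign {F : Set P} {t : Equiv.Perm P} (hF : IsUpperSet F) (ht : IsTurn F t)
    (x y : P) : cmpSign (t x) (t y) =
      cmpSign x y + (if x ∈ F then 1 else 0) - (if y ∈ F then 1 else 0) := by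
  have h1 := ht x y
  have h2 := ht y x
  have h3 : x ≤ y → x ∈ F → y ∈ F := fun h hx => hF h hx
  have h4 : y ≤ x → y ∈ F → x ∈ F := fun h hx => hF h hx
  unfold RandomPoset.cmpSign
  rw [if_congr h1 rfl rfl, if_congr h2 rfl rfl]
  change _ = RandomPoset.cmpSign x y + _ - _
  rw [cmpSign_eq_ite]
  simp only [Incomp, lt_iff_le_not_ge]
  grind

theorem IsTurn.triSign {F : Set P} {t : Equiv.Perm P} (hF : IsUpperSet F) (ht : IsTurn F t)
    (x y z : P) : triSign (t x) (t y) (t z) = triSign x y z := by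
  unfold RandomPoset.triSign
  rw [ht.cmpSign hF, ht.cmpSign hF, ht.cmpSign hF]; ring

theorem IsReversal.lt_iff {r : Equiv.Perm P} (hr : IsReversal r) (x y : P) :
    r x < r y ↔ y < x := by
  rw [lt_iff_le_not_ge, lt_iff_le_not_ge, hr, hr]

theorem IsReversal.cmpSign {r : Equiv.Perm P} (hr : IsReversal r) (x y : P) :
    cmpSign (r x) (r y) = -cmpSign x y := by
  rw [cmpSign_swap x y, neg_neg]
  exact cmpSign_congr (hr.lt_iff x y) (hr.lt_iff y x)

theorem IsReversal.triSign {r : Equiv.Perm P} (hr : IsReversal r) (x y z : P) :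
    triSign (r x) (r y) (r z) = -triSign x y z := by
  unfold RandomPoset.triSign
  rw [hr.cmpSign, hr.cmpSign, hr.cmpSign]; ring

theorem cmpSign_of_mem_autOrder {g : Equiv.Perm P} (hg : g ∈ autOrder P) (x y : P) :
    cmpSign (g x) (g y) = cmpSign x y := by
  have h : ∀ a b, g a ≤ g b ↔ a ≤ b := hg
  have h' : ∀ a b, g a < g b ↔ a < b := fun a b => by rw [lt_iff_le_not_ge, h, h, lt_iff_le_not_ge]
  exact cmpSign_congr (h' x y) (h' y x)

theorem triSign_of_mem_autOrder {g : Equiv.Perm P} (hg : g ∈ autOrder P) (x y z : P) :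
    triSign (g x) (g y) (g z) = triSign x y z := by
  unfold triSign
  simp only [cmpSign_of_mem_autOrder hg]

theorem orderIso_mem_autOrder (g : P ≃o P) : g.toEquiv ∈ autOrder P :=
  fun _ _ => g.le_iff_le

end Sign

/-! ### Closed permutation groups -/

section ClosedGroup

variable {P : Type*}

theorem subset_closedGroup (A : Set (Equiv.Perm P)) : A ⊆ closedGroup A := fun _ ha =>
  Subgroup.mem_sInf.2 fun _ hG => hG.2 ha

theorem isClosedGroup_closedGroup (A : Set (Equiv.Perm P)) : IsClosedGroup (closedGroup A) := by
  intro f hf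
  refine Subgroup.mem_sInf.2 fun G hG => hG.1 f fun S => ?_
  obtain ⟨g, hg, h⟩ := hf S
  exact ⟨g, Subgroup.mem_sInf.1 hg G hG, h⟩

theorem closedGroup_le {A : Set (Equiv.Perm P)} {G : Subgroup (Equiv.Perm P)}
    (hG : IsClosedGroup G) (h : A ⊆ G) : closedGroup A ≤ G := sInf_le ⟨hG, h⟩

theorem closedGroup_mono {A B : Set (Equiv.Perm P)} (h : A ⊆ B) :
    closedGroup A ≤ closedGroup B :=
  closedGroup_le (isClosedGroup_closedGroup B) (h.trans (subset_closedGroup B))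

theorem isClosedGroup_autBinary (ρ : P → P → Prop) : IsClosedGroup (autBinary ρ) := by
  classical
  intro f hf a b
  obtain ⟨g, hg, h⟩ := hf {a, b}
  rw [← h a (by simp), ← h b (by simp)]
  exact hg a b

theorem isClosedGroup_autTernary (ρ : P → P → P → Prop) : IsClosedGroup (autTernary ρ) := by
  classical
  intro f hf a b c
  obtain ⟨g, hg, h⟩ := hf {a, b, c}
  rw [← h a (by simp), ← h b (by simp), ← h c (by simp)]
  exact hg a b c

end ClosedGroup

/-! ### Invariance of the relations, and the group T -/

section Groups

variable {P : Type*} [PartialOrder P]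

theorem mem_autTernary_cyc {f : Equiv.Perm P}
    (hf : ∀ a b c, triSign (f a) (f b) (f c) = triSign a b c) : f ∈ autTernary (Cyc (P := P)) :=
  fun a b c => by rw [cyc_iff_triSign, cyc_iff_triSign, hf]

/-- `Cyc` detects the value 1, and on the triple with two entries exchanged it detects -1; the bound
on `triSign` leaves only 0. -/
theorem triSign_of_mem_autTernary_cyc {f : Equiv.Perm P} (hf : f ∈ autTernary (Cyc (P := P)))
    (a b c : P) : triSign (f a) (f b) (f c) = triSign a b c := by
  have h1 := hf a b c
  have h2 := hf b a c
  rw [cyc_iff_triSign, cyc_iff_triSign] at h1 h2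
  rw [triSign_swap (f b), triSign_swap b] at h2
  have := triSign_mem a b c
  have := triSign_mem (f a) (f b) (f c)
  omega

theorem mem_autTernary_pari {f : Equiv.Perm P}
    (hf : ∀ a b c, triSign (f a) (f b) (f c) = 0 ↔ triSign a b c = 0) :
    f ∈ autTernary (Pari (P := P)) :=
  fun a b c => by
    rw [pari_iff_triSign, pari_iff_triSign, hf, f.injective.ne_iff, f.injective.ne_iff,
      f.injective.ne_iff]

theorem triSign_of_mem_autTernary_pari {f : Equiv.Perm P} (hf : f ∈ autTernary (Pari (P := P)))
    (a b c : P) : triSign (f a) (f b) (f c) = 0 ↔ triSign a b c = 0 := by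
  by_cases hd : a ≠ b ∧ b ≠ c ∧ c ≠ a
  · have h := hf a b c
    rw [pari_iff_triSign, pari_iff_triSign, f.injective.ne_iff, f.injective.ne_iff,
      f.injective.ne_iff, and_iff_left hd, and_iff_left hd] at h
    exact h
  · have h : ∀ a b c : P, ¬ (a ≠ b ∧ b ≠ c ∧ c ≠ a) → triSign a b c = 0 := by
      intro a b c h
      by_cases h1 : a = b
      · rw [h1, triSign_self]
      by_cases h2 : b = c
      · rw [triSign_rotate, h2, triSign_self]
      · rw [not_not.1 fun h3 => h ⟨h1, h2, h3⟩, triSign_rotate, triSign_rotate, triSign_self]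
    rw [h a b c hd, h (f a) (f b) (f c) (by simpa using hd)]

theorem mem_groupT (t : Equiv.Perm P) : t ∈ groupT t :=
  subset_closedGroup _ (Or.inr rfl)

theorem autOrder_le_groupT (t : Equiv.Perm P) : autOrder P ≤ groupT t :=
  Set.subset_union_left.trans (subset_closedGroup _)

theorem groupT_le {F : Set P} {t : Equiv.Perm P} (hF : IsUpperSet F) (ht : IsTurn F t) :
    groupT t ≤ autTernary (Cyc (P := P)) := by
  refine closedGroup_le (isClosedGroup_autTernary _) (Set.union_subset ?_ ?_)
  · exact fun g hg => mem_autTernary_cyc fun a b c => triSign_of_mem_autOrder hg a b c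
  · rintro _ rfl
    exact mem_autTernary_cyc (ht.triSign hF)

theorem groupM_le {F : Set P} {r t : Equiv.Perm P} (hr : IsReversal r) (hF : IsUpperSet F)
    (ht : IsTurn F t) : groupM r t ≤ autTernary (Pari (P := P)) := by
  refine closedGroup_le (isClosedGroup_autTernary _) (Set.union_subset ?_ ?_)
  · exact fun g hg => mem_autTernary_pari fun a b c => by rw [triSign_of_mem_autOrder hg a b c]
  · rintro _ (rfl | rfl)
    · exact mem_autTernary_pari fun a b c => by rw [hr.triSign, neg_eq_zero]
    · exact mem_autTernary_pari fun a b c => by rw [ht.triSign hF]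

theorem groupT_le_groupM (r t : Equiv.Perm P) : groupT t ≤ groupM r t :=
  closedGroup_mono (Set.union_subset_union_right _ (by simp))

open Classical in
/-- Every finite suborder can be turned around any of its upper sets by a member of `T`. -/
theorem exists_turn_on (hP : IsRandomPoset P) {F : Set P} (hF : IsRandomFilter F)
    {t : Equiv.Perm P} (ht : IsTurn F t) (S : Finset P) (U : Set P)
    (hU : ∀ x ∈ S, ∀ y ∈ S, x ≤ y → x ∈ U → y ∈ U) :
    ∃ g ∈ groupT t, ∀ x ∈ S, ∀ y ∈ S, cmpSign (g x) (g y) =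
      cmpSign x y + (if x ∈ U then 1 else 0) - (if y ∈ U then 1 else 0) := by
  obtain ⟨e, he⟩ := hF.exists_embedding S (U := {x | x.1 ∈ U})
    fun x y hxy hx => hU x x.2 y y.2 hxy hx
  obtain ⟨α, hα⟩ := hP.homogeneous S (fun x => if h : x ∈ S then e ⟨x, h⟩ else x)
    fun x hx y hy => by simp [hx, hy]
  have hαF : ∀ x ∈ S, α x ∈ F ↔ x ∈ U := fun x hx => by
    rw [hα x hx, dif_pos hx, he]; rfl
  refine ⟨t * α.toEquiv, mul_mem (mem_groupT t) (autOrder_le_groupT t (orderIso_mem_autOrder α)),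
    fun x hx y hy => ?_⟩
  rw [Equiv.Perm.mul_apply, Equiv.Perm.mul_apply, ht.cmpSign hF.upper,
    cmpSign_of_mem_autOrder (orderIso_mem_autOrder α)]
  change _ + (if α x ∈ F then 1 else 0) - (if α y ∈ F then 1 else 0) = _
  rw [if_congr (hαF x hx) rfl rfl, if_congr (hαF y hy) rfl rfl]

/-- Members of `T` realize every admissible shift of `cmpSign` on a finite set. -/
theorem exists_shift_on (hP : IsRandomPoset P) {F : Set P} (hF : IsRandomFilter F)
    {t : Equiv.Perm P} (ht : IsTurn F t) (S : Finset P) (k : P → ℤ)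
    (hk : ∀ x ∈ S, 0 ≤ k x ∧ k x ≤ 2)
    (hd : ∀ x ∈ S, ∀ y ∈ S, cmpSign x y + k x - k y ≤ 1) :
    ∃ g ∈ groupT t, ∀ x ∈ S, ∀ y ∈ S, cmpSign (g x) (g y) = cmpSign x y + k x - k y := by
  classical
  have up : ∀ x y : P, x ≤ y → cmpSign x y = 1 ∨ x = y := fun x y h =>
    (lt_or_eq_of_le h).imp_left cmpSign_eq_one.2
  -- Since `0 ≤ k ≤ 2`, `k` is the sum of the indicators of `1 ≤ k` and `2 ≤ k`, so two successive
  -- turns suffice. The bound `hd` makes the first level set upward closed in the original order and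
  -- the second one in the order after the first turn.
  obtain ⟨g, hg, h1⟩ := exists_turn_on hP hF ht S {x | 1 ≤ k x} (by
    intro x hx y hy hxy (hkx : 1 ≤ k x)
    change 1 ≤ k y
    rcases up x y hxy with h | rfl
    · have := hd x hx y hy
      omega
    · exact hkx)
  obtain ⟨g', hg', h2⟩ := exists_turn_on hP hF ht (S.image g) {x | 2 ≤ k (g.symm x)} (by
    simp only [Finset.mem_image]
    rintro _ ⟨x, hx, rfl⟩ _ ⟨y, hy, rfl⟩ hxy
    simp only [Set.mem_ofPred_eq, Equiv.symm_apply_apply]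
    intro hkx
    rcases up _ _ hxy with h | h
    · have := hd x hx y hy
      have := hk y hy
      rw [h1 x hx y hy] at h
      simp only [Set.mem_ofPred_eq] at h
      split_ifs at h <;> omega
    · rwa [← g.injective h])
  refine ⟨g' * g, mul_mem hg' hg, fun x hx y hy => ?_⟩
  rw [Equiv.Perm.mul_apply, Equiv.Perm.mul_apply, h2 _ (Finset.mem_image_of_mem _ hx) _
    (Finset.mem_image_of_mem _ hy), h1 x hx y hy]
  simp only [Set.mem_ofPred_eq, Equiv.symm_apply_apply]
  have := hk x hx
  have := hk y hy
  split_ifs <;> omega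

/-- A finite partial map that preserves `triSign` is the restriction of a member of `T`. -/
theorem exists_mem_groupT_eq_on (hP : IsRandomPoset P) {F : Set P} (hF : IsRandomFilter F)
    {t : Equiv.Perm P} (ht : IsTurn F t) (S : Finset P) (f : P → P) (hf : Set.InjOn f S)
    (hs : ∀ x ∈ S, ∀ y ∈ S, ∀ z ∈ S, triSign (f x) (f y) (f z) = triSign x y z) :
    ∃ g ∈ groupT t, ∀ x ∈ S, g x = f x := by
  classical
  rcases S.eq_empty_or_nonempty with rfl | ⟨a, ha⟩
  · exact ⟨1, one_mem _, by simp⟩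
  -- The change of `cmpSign` under `f` has zero coboundary, so it is the coboundary of its values at
  -- the base point `a`. Subtracting the minimum makes this potential nonnegative. It is at most 2,
  -- because its difference from the minimum is a difference of two signs.
  let k₀ : P → ℤ := fun x => cmpSign (f x) (f a) - cmpSign x a
  obtain ⟨m, hm, hmin⟩ := S.exists_min_image k₀ ⟨a, ha⟩
  have hk₀ : ∀ x ∈ S, ∀ y ∈ S, cmpSign x y + k₀ x - k₀ y = cmpSign (f x) (f y) := by
    intro x hx y hy
    have h := hs x hx y hy a ha
    unfold triSign at h
    rw [cmpSign_swap (f a), cmpSign_swap a] at h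
    simp only [k₀]
    omega
  obtain ⟨g, hg, h⟩ := exists_shift_on hP hF ht S (fun x => k₀ x - k₀ m)
    (fun x hx => by
      have h1 := hmin x hx
      have h2 := hk₀ x hx m hm
      have h3 := cmpSign_mem x m
      have h4 := cmpSign_mem (f x) (f m)
      have h5 := cmpSign_eq_one (a := x) (b := m)
      omega)
    (fun x hx y hy => by
      have h1 := hk₀ x hx y hy
      have h2 := cmpSign_mem (f x) (f y)
      omega)
  have hgf : ∀ x ∈ S, ∀ y ∈ S, cmpSign (g x) (g y) = cmpSign (f x) (f y) := fun x hx y hy => by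
    rw [h x hx y hy, ← hk₀ x hx y hy]; ring
  obtain ⟨β, hβ⟩ := hP.homogeneous (S.image g) (fun x => f (g.symm x)) (by
    simp only [Finset.mem_image]
    rintro _ ⟨x, hx, rfl⟩ _ ⟨y, hy, rfl⟩
    rw [Equiv.symm_apply_apply, Equiv.symm_apply_apply]
    refine le_iff_of_cmpSign_eq (hgf x hx y hy).symm ?_
    rw [g.injective.eq_iff, hf.eq_iff hx hy])
  refine ⟨β.toEquiv * g, mul_mem (autOrder_le_groupT t (orderIso_mem_autOrder β)) hg,
    fun x hx => ?_⟩
  have := hβ _ (Finset.mem_image_of_mem g hx)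
  rwa [Equiv.symm_apply_apply] at this

theorem groupT_eq (hP : IsRandomPoset P) {F : Set P} (hF : IsRandomFilter F)
    {t : Equiv.Perm P} (ht : IsTurn F t) : groupT t = autTernary (Cyc (P := P)) := by
  refine le_antisymm (groupT_le hF.upper ht) fun f hf => ?_
  exact isClosedGroup_closedGroup _ f fun S => exists_mem_groupT_eq_on hP hF ht S f
    f.injective.injOn fun x _ y _ z _ => triSign_of_mem_autTernary_cyc hf x y z

/-- Triples of distinct points with the same `triSign` are in the same orbit of `T`. -/
theorem exists_mem_groupT_triple (hP : IsRandomPoset P) {F : Set P} (hF : IsRandomFilter F)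
    {t : Equiv.Perm P} (ht : IsTurn F t) {a b c a' b' c' : P} (hab : a ≠ b) (hbc : b ≠ c)
    (hca : c ≠ a) (hab' : a' ≠ b') (hbc' : b' ≠ c') (hca' : c' ≠ a')
    (h : triSign a b c = triSign a' b' c') :
    ∃ g ∈ groupT t, g a = a' ∧ g b = b' ∧ g c = c' := by
  classical
  let f : P → P := fun x => if x = a then a' else if x = b then b' else c'
  have fa : f a = a' := by simp [f]
  have fb : f b = b' := by simp [f, hab.symm]
  have fc : f c = c' := by simp [f, hca, hbc.symm]
  -- `triSign` is alternating, so on three points it is determined by one value.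
  have key : ∀ x ∈ ({a, b, c} : Finset P), ∀ y ∈ ({a, b, c} : Finset P),
      ∀ z ∈ ({a, b, c} : Finset P), triSign (f x) (f y) (f z) = triSign x y z := by
    have e1 := cmpSign_swap a b
    have e2 := cmpSign_swap b c
    have e3 := cmpSign_swap c a
    have e4 := cmpSign_swap a' b'
    have e5 := cmpSign_swap b' c'
    have e6 := cmpSign_swap c' a'
    unfold triSign at h ⊢
    simp only [Finset.mem_insert, Finset.mem_singleton]
    rintro x (rfl | rfl | rfl) y (rfl | rfl | rfl) z (rfl | rfl | rfl) <;>
      simp only [fa, fb, fc, cmpSign_self] <;> omega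
  have hinj : Set.InjOn f ({a, b, c} : Finset P) := by
    simp only [Set.InjOn, Finset.coe_insert, Finset.coe_singleton, Set.mem_insert_iff,
      Set.mem_singleton_iff]
    rintro x (rfl | rfl | rfl) y (rfl | rfl | rfl) <;>
      simp [fa, fb, fc, hab', hbc', hca', hab'.symm, hbc'.symm, hca'.symm]
  obtain ⟨g, hg, hgf⟩ := exists_mem_groupT_eq_on hP hF ht {a, b, c} f hinj key
  exact ⟨g, hg, (hgf a (by simp)).trans fa, (hgf b (by simp)).trans fb,
    (hgf c (by simp)).trans fc⟩

theorem ne_of_triSign_eq_one {a b c : P} (h : triSign a b c = 1) : a ≠ b ∧ b ≠ c ∧ c ≠ a := by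
  refine ⟨?_, ?_, ?_⟩
  · rintro rfl
    simp [triSign_self] at h
  · rintro rfl
    simp [triSign_rotate a, triSign_self] at h
  · rintro rfl
    simp [triSign_rotate _ b, triSign_rotate b, triSign_self] at h

theorem tripleOrbit_cyc (hP : IsRandomPoset P) {F : Set P} (hF : IsRandomFilter F)
    {t : Equiv.Perm P} (ht : IsTurn F t) {a b c : P} (hab : a < b) (hbc : b < c) :
    tripleOrbit (groupT t) a b c = {v | Cyc v.1 v.2.1 v.2.2} := by
  have h : Cyc a b c := Or.inl ⟨hab, hbc⟩
  ext ⟨x, y, z⟩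
  constructor
  · rintro ⟨g, hg, hv⟩
    simp only [Prod.mk.injEq] at hv
    obtain ⟨rfl, rfl, rfl⟩ := hv
    exact (groupT_le hF.upper ht hg a b c).2 h
  · intro (hv : Cyc x y z)
    rw [cyc_iff_triSign] at h hv
    obtain ⟨h1, h2, h3⟩ := ne_of_triSign_eq_one h
    obtain ⟨h4, h5, h6⟩ := ne_of_triSign_eq_one hv
    obtain ⟨g, hg, rfl, rfl, rfl⟩ := exists_mem_groupT_triple hP hF ht h1 h2 h3 h4 h5 h6
      (h.trans hv.symm)
    exact ⟨g, hg, rfl⟩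

theorem tripleOrbit_pari (hP : IsRandomPoset P) {F : Set P} (hF : IsRandomFilter F)
    {t : Equiv.Perm P} (ht : IsTurn F t) {a b c : P} (hab : Incomp a b) (hbc : Incomp b c)
    (hca : Incomp c a) :
    tripleOrbit (groupT t) a b c = {v | Pari v.1 v.2.1 v.2.2} := by
  have h : triSign a b c = 0 := by simp [triSign, hab.cmpSign_eq, hbc.cmpSign_eq, hca.cmpSign_eq]
  ext ⟨x, y, z⟩
  constructor
  · rintro ⟨g, hg, hv⟩
    simp only [Prod.mk.injEq] at hv
    obtain ⟨rfl, rfl, rfl⟩ := hv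
    refine (pari_iff_triSign _ _ _).2 ⟨?_, by simpa using hab.ne, by simpa using hbc.ne,
      by simpa using hca.ne⟩
    rw [triSign_of_mem_autTernary_cyc (groupT_le hF.upper ht hg), h]
  · intro (hv : Pari x y z)
    rw [pari_iff_triSign] at hv
    obtain ⟨h0, h4, h5, h6⟩ := hv
    obtain ⟨g, hg, rfl, rfl, rfl⟩ := exists_mem_groupT_triple hP hF ht hab.ne hbc.ne hca.ne
      h4 h5 h6 (h.trans h0.symm)
    exact ⟨g, hg, rfl⟩

/-- Two comparable pairs incomparable to the points of `C` are joined by a path of comparable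
pairs in which consecutive pairs share a lower or an upper end, the other ends being
incomparable. -/
theorem HasExtensions.comparable_pair_induction (hP : HasExtensions P) (C : Finset P)
    (p : P → P → Prop)
    (h_up : ∀ a b c, a < b → a < c → Incomp b c → (∀ x ∈ C, Incomp x a ∧ Incomp x b ∧ Incomp x c) →
      (p a b ↔ p a c))
    (h_down : ∀ a b c, b < a → c < a → Incomp b c →
      (∀ x ∈ C, Incomp x a ∧ Incomp x b ∧ Incomp x c) → (p b a ↔ p c a))
    {a b c d : P} (hab : a < b) (hcd : c < d)
    (hC : ∀ x ∈ C, Incomp x a ∧ Incomp x b ∧ Incomp x c ∧ Incomp x d) : p a b ↔ p c d := by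
  classical
  obtain ⟨e, -, -, he⟩ := hP ∅ ∅ (C ∪ {a, b, c, d}) (by simp) (by simp) (by simp)
  simp only [Finset.mem_union, Finset.mem_insert, Finset.mem_singleton] at he
  obtain ⟨f, hf, -, hf'⟩ := hP {e} ∅ (C ∪ {a, b, c, d}) (by simp)
    (by
      simp only [Finset.mem_singleton, forall_eq, Finset.mem_union, Finset.mem_insert]
      exact fun x hx => (he x hx).1)
    (by simp)
  simp only [Finset.mem_union, Finset.mem_insert, Finset.mem_singleton, forall_eq] at hf hf'
  -- The pair `e < f` lies apart from all the given points. With `y` above `a` and `e` and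
  -- incomparable to `b` and `f`, the path is `a < b`, `a < y`, `e < y`, `e < f`.
  have main : ∀ a b, a < b → (∀ x ∈ C, Incomp x a ∧ Incomp x b) → Incomp a e → Incomp b e →
      Incomp a f → Incomp b f → (p a b ↔ p e f) := by
    intro a b hab hC hae hbe haf hbf
    obtain ⟨y, hy, -, hy'⟩ := hP {a, e} ∅ (C ∪ {b, f}) (by simp)
      (by
        simp only [Finset.mem_singleton, Finset.mem_union, Finset.mem_insert]
        rintro x (hx | rfl | rfl) z (rfl | rfl)
        · exact (hC x hx).1.1
        · exact (he x (Or.inl hx)).1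
        · exact hab.not_ge
        · exact hbe.1
        · exact haf.2
        · exact hf.not_ge)
      (by simp)
    simp only [Finset.mem_union, Finset.mem_insert, Finset.mem_singleton, forall_eq_or_imp,
      forall_eq] at hy hy'
    have hyC : ∀ x ∈ C, Incomp x y := fun x hx => hy' x (Or.inl hx)
    have heC : ∀ x ∈ C, Incomp x e := fun x hx => he x (Or.inl hx)
    rw [h_up a b y hab hy.1 (hy' b (Or.inr (Or.inl rfl)))
        fun x hx => ⟨(hC x hx).1, (hC x hx).2, hyC x hx⟩,
      h_down y a e hy.1 hy.2 hae fun x hx => ⟨hyC x hx, (hC x hx).1, heC x hx⟩,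
      h_up e y f hy.2 hf (hy' f (Or.inr (Or.inr rfl))).symm
        fun x hx => ⟨heC x hx, hyC x hx, hf' x (Or.inl hx)⟩]
  rw [main a b hab (fun x hx => ⟨(hC x hx).1, (hC x hx).2.1⟩) (he a (by simp)) (he b (by simp))
      (hf' a (by simp)) (hf' b (by simp)),
    main c d hcd (fun x hx => ⟨(hC x hx).2.2.1, (hC x hx).2.2.2⟩) (he c (by simp))
      (he d (by simp)) (hf' c (by simp)) (hf' d (by simp))]

/-! ### The groups R and M: constancy of the sign -/

theorem groupR_eq (hP : HasExtensions P) {r : Equiv.Perm P} (hr : IsReversal r) :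
    groupR r = autBinary (Incomp (P := P)) := by
  have hA : autOrder P ≤ groupR r := Set.subset_union_left.trans (subset_closedGroup _)
  have hrR : r ∈ groupR r := subset_closedGroup _ (Or.inr rfl)
  apply le_antisymm
  · refine closedGroup_le (isClosedGroup_autBinary _) (Set.union_subset ?_ ?_)
    · intro g (hg : ∀ a b, g a ≤ g b ↔ a ≤ b) a b
      simp only [Incomp, hg]
    · rintro _ rfl a b
      simp only [Incomp, hr a b, hr b a, and_comm]
  · intro f (hf : ∀ a b, Incomp (f a) (f b) ↔ Incomp a b)
    have hcomp : ∀ a b, a < b → f a < f b ∨ f b < f a := by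
      intro a b hab
      have h1 := (hf a b).not.2 fun h => h.1 hab.le
      have h2 : f a ≠ f b := f.injective.ne hab.ne
      rw [Incomp, not_and_or, not_not, not_not] at h1
      exact h1.imp (fun h => lt_of_le_of_ne h h2) fun h => lt_of_le_of_ne h h2.symm
    -- If two comparable pairs share an end and their other ends are incomparable, the images of
    -- these ends are incomparable too. So the image of the shared end lies on the same side of
    -- both, since otherwise transitivity would make them comparable.
    have key : ∀ {a b c d : P}, a < b → c < d → (f a < f b ↔ f c < f d) := by
      intro a b c d hab hcd
      refine hP.comparable_pair_induction ∅ (fun a b => f a < f b) ?_ ?_ hab hcd (by simp)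
      · intro a b c hab hac hbc _
        have hbc := (hf b c).2 hbc
        constructor <;> intro h
        · exact (hcomp a c hac).resolve_right fun h' => hbc.2 (h'.trans h).le
        · exact (hcomp a b hab).resolve_right fun h' => hbc.1 (h'.trans h).le
      · intro a b c hab hac hbc _
        have hbc := (hf b c).2 hbc
        constructor <;> intro h
        · exact (hcomp c a hac).resolve_right fun h' => hbc.1 (h.trans h').le
        · exact (hcomp b a hab).resolve_right fun h' => hbc.2 (h.trans h').le
    have inc : ∀ a b, ¬ a ≤ b → ¬ b ≤ a → Incomp (f a) (f b) := fun a b h1 h2 =>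
      (hf a b).2 ⟨h1, h2⟩
    by_cases hmono : ∀ a b, a < b → f a < f b
    · refine hA fun a b => ⟨fun h => ?_, fun h => ?_⟩
      · by_contra hab
        by_cases hba : b ≤ a
        · exact (hmono b a (lt_of_le_not_ge hba hab)).not_ge h
        · exact (inc a b hab hba).1 h
      · rcases h.eq_or_lt with rfl | h
        · exact le_rfl
        · exact (hmono a b h).le
    · push Not at hmono
      obtain ⟨c, d, hcd, hn⟩ := hmono
      have hanti : ∀ a b, a < b → f b < f a := fun a b hab =>
        (hcomp a b hab).resolve_left fun h => hn ((key hab hcd).1 h)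
      have hrf : r * f ∈ autOrder P := fun a b => by
        change r (f a) ≤ r (f b) ↔ a ≤ b
        rw [hr]
        refine ⟨fun h => ?_, fun h => ?_⟩
        · by_contra hab
          by_cases hba : b ≤ a
          · exact (hanti b a (lt_of_le_not_ge hba hab)).not_ge h
          · exact (inc a b hab hba).2 h
        · rcases h.eq_or_lt with rfl | h
          · exact le_rfl
          · exact (hanti a b h).le
      have := mul_mem (inv_mem hrR) (hA hrf)
      rwa [inv_mul_cancel_left] at this

/-- A permutation that preserves `pari` acts with a constant sign on the comparable pairs that are
incomparable to a given point. -/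
theorem triSign_eq_of_incomp (hP : HasExtensions P) {f : Equiv.Perm P}
    (hf : f ∈ autTernary (Pari (P := P))) {p a b c d : P} (hab : a < b) (hcd : c < d)
    (ha : Incomp p a) (hb : Incomp p b) (hc : Incomp p c) (hd : Incomp p d) :
    triSign (f p) (f a) (f b) = 1 ↔ triSign (f p) (f c) (f d) = 1 := by
  have h0 := triSign_of_mem_autTernary_pari hf
  refine hP.comparable_pair_induction {p} (fun a b => triSign (f p) (f a) (f b) = 1) ?_ ?_ hab hcd
    (by simp [ha, hb, hc, hd])
  · intro a b c hab hac hbc hp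
    obtain ⟨pa, pb, pc⟩ := hp p (by simp)
    have h1 := (h0 p b c).2 (by
      simp [triSign, pb.cmpSign_eq, hbc.cmpSign_eq, pc.symm.cmpSign_eq])
    have h2 := (h0 a b c).2 (by
      simp [triSign, cmpSign_eq_one.2 hab, hbc.cmpSign_eq, cmpSign_eq_neg_one.2 hac])
    -- Two of the four terms vanish, since `f` preserves zeros of `triSign` and both `p, b, c` and
    -- `a, b, c` have value 0. The other two terms are therefore equal.
    have := triSign_cocycle (f p) (f a) (f b) (f c)
    rw [h1, h2] at this
    constructor <;> intro h <;> linarith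
  · intro a b c hab hac hbc hp
    obtain ⟨pa, pb, pc⟩ := hp p (by simp)
    have h1 := (h0 p b c).2 (by
      simp [triSign, pb.cmpSign_eq, hbc.cmpSign_eq, pc.symm.cmpSign_eq])
    have h2 := (h0 b c a).2 (by
      simp [triSign, cmpSign_eq_one.2 hac, hbc.cmpSign_eq, cmpSign_eq_neg_one.2 hab])
    have := triSign_cocycle (f p) (f b) (f c) (f a)
    rw [h1, h2] at this
    constructor <;> intro h <;> linarith

/-- Shifting by `1 + cmpSign p x` through T makes `p` incomparable to the other points and turns the
sign of a pair `x, y` into `triSign p x y`. The two triples become comparable pairs incomparable to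
a common point, which is the case already settled. -/
theorem triSign_eq_of_common_point (hP : IsRandomPoset P) {F : Set P} (hF : IsRandomFilter F)
    {t : Equiv.Perm P} (ht : IsTurn F t) {f : Equiv.Perm P}
    (hf : f ∈ autTernary (Pari (P := P))) {p a b c d : P} (hab : triSign p a b = 1)
    (hcd : triSign p c d = 1) :
    triSign (f p) (f a) (f b) = 1 ↔ triSign (f p) (f c) (f d) = 1 := by
  classical
  obtain ⟨g, hg, h⟩ := exists_shift_on hP hF ht {p, a, b, c, d} (fun x => 1 + cmpSign p x)
    (fun x _ => by have := cmpSign_mem p x; omega)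
    (fun x _ y _ => by
      have := (triSign_mem p x y).2
      unfold triSign at this
      rw [cmpSign_swap y p] at this
      omega)
  have hgT := triSign_of_mem_autTernary_cyc (groupT_le hF.upper ht hg)
  have hfg : f * g⁻¹ ∈ autTernary (Pari (P := P)) :=
    mul_mem hf (inv_mem (mem_autTernary_pari fun a b c => by rw [hgT]))
  have hinc : ∀ x ∈ ({p, a, b, c, d} : Finset P), x ≠ p → Incomp (g p) (g x) := by
    intro x hx hxp
    have h0 := h p (by simp) x hx
    rw [cmpSign_self] at h0
    have h1 : cmpSign (g p) (g x) = 0 := by rw [h0]; ring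
    exact (cmpSign_eq_zero.1 h1).resolve_left fun e => hxp (g.injective e).symm
  have hlt : ∀ x ∈ ({p, a, b, c, d} : Finset P), ∀ y ∈ ({p, a, b, c, d} : Finset P),
      triSign p x y = 1 → g x < g y := by
    intro x hx y hy hxy
    rw [← cmpSign_eq_one, h x hx y hy, ← hxy, triSign, cmpSign_swap y p]
    ring
  obtain ⟨h1, -, h2⟩ := ne_of_triSign_eq_one hab
  obtain ⟨h3, -, h4⟩ := ne_of_triSign_eq_one hcd
  simpa using triSign_eq_of_incomp hP.hasExtensions hfg
    (hlt a (by simp) b (by simp) hab) (hlt c (by simp) d (by simp) hcd)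
    (hinc a (by simp) h1.symm) (hinc b (by simp) h2)
    (hinc c (by simp) h3.symm) (hinc d (by simp) h4)

/-- The triple found here links two base points: it shares a point with a triple through `a` and
another with a triple through `b`. -/
theorem HasExtensions.exists_triSign_eq_one (hP : HasExtensions P) {a b : P} (hab : a ≠ b) :
    ∃ x, triSign a b x = 1 := by
  classical
  by_cases h1 : a ≤ b
  · obtain ⟨x, -, -, hx⟩ := hP ∅ ∅ {a, b} (by simp) (by simp) (by simp)
    refine ⟨x, ?_⟩
    simp [triSign, cmpSign_eq_one.2 (lt_of_le_of_ne h1 hab), (hx b (by simp)).cmpSign_eq,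
      (hx a (by simp)).symm.cmpSign_eq]
  by_cases h2 : b ≤ a
  · have hba := lt_of_le_not_ge h2 h1
    obtain ⟨x, hx, hx', -⟩ := hP {b} {a} ∅ (by simpa using hba) (by simp) (by simp)
    refine ⟨x, ?_⟩
    simp [triSign, cmpSign_eq_neg_one.2 hba, cmpSign_eq_one.2 (hx b (by simp)),
      cmpSign_eq_one.2 (hx' a (by simp))]
  · obtain ⟨x, hx, -, hx'⟩ := hP {b} ∅ {a} (by simp) (by simpa using h1) (by simp)
    refine ⟨x, ?_⟩
    simp [triSign, Incomp.cmpSign_eq ⟨h1, h2⟩, cmpSign_eq_one.2 (hx b (by simp)),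
      (hx' a (by simp)).symm.cmpSign_eq]

theorem triSign_eq_of_mem_autTernary_pari (hP : IsRandomPoset P) {F : Set P}
    (hF : IsRandomFilter F) {t : Equiv.Perm P} (ht : IsTurn F t) {f : Equiv.Perm P}
    (hf : f ∈ autTernary (Pari (P := P))) {a b c a' b' c' : P} (h : triSign a b c = 1)
    (h' : triSign a' b' c' = 1) :
    triSign (f a) (f b) (f c) = 1 ↔ triSign (f a') (f b') (f c') = 1 := by
  by_cases hne : a = a'
  · subst hne
    exact triSign_eq_of_common_point hP hF ht hf h h'
  · obtain ⟨x, hx⟩ := hP.hasExtensions.exists_triSign_eq_one hne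
    rw [triSign_eq_of_common_point hP hF ht hf h hx, triSign_rotate,
      triSign_eq_of_common_point hP hF ht hf ((triSign_rotate a a' x).symm.trans hx) h']

theorem groupM_eq (hP : IsRandomPoset P) {F : Set P} (hF : IsRandomFilter F)
    {r t : Equiv.Perm P} (hr : IsReversal r) (ht : IsTurn F t) :
    groupM r t = autTernary (Pari (P := P)) := by
  refine le_antisymm (groupM_le hr hF.upper ht) fun f hf => ?_
  have h0 := triSign_of_mem_autTernary_pari hf
  have hT : autTernary (Cyc (P := P)) ≤ groupM r t :=
    (groupT_eq hP hF ht).symm.trans_le (groupT_le_groupM r t)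
  have hrM : r ∈ groupM r t := subset_closedGroup _ (Or.inr (Or.inl rfl))
  -- By constancy of the sign, either every triple of value 1 keeps its value or every one goes to
  -- -1. In the second case `r * f` preserves `triSign`.
  by_cases hone : ∀ a b c, triSign a b c = 1 → triSign (f a) (f b) (f c) = 1
  · refine hT (mem_autTernary_cyc fun a b c => ?_)
    have h1 := hone a b c
    have h2 := hone b a c
    rw [triSign_swap (f b), triSign_swap b] at h2
    have := h0 a b c
    have := triSign_mem a b c
    omega
  · push Not at hone
    obtain ⟨a', b', c', h, h'⟩ := hone
    have hneg : ∀ a b c, triSign a b c = 1 → triSign (f a) (f b) (f c) = -1 := by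
      intro a b c habc
      have h1 := (triSign_eq_of_mem_autTernary_pari hP hF ht hf habc h).not.2 h'
      have h2 := h0 a b c
      have h3 := triSign_mem (f a) (f b) (f c)
      omega
    have hrf : r * f ∈ autTernary (Cyc (P := P)) := mem_autTernary_cyc fun a b c => by
      rw [Equiv.Perm.mul_apply, Equiv.Perm.mul_apply, Equiv.Perm.mul_apply, hr.triSign]
      have h1 := hneg a b c
      have h2 := hneg b a c
      rw [triSign_swap (f b), triSign_swap b] at h2
      have := h0 a b c
      have := triSign_mem a b c
      omega
    have := mul_mem (inv_mem hrM) (hT hrf)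
    rwa [inv_mul_cancel_left] at this

end Groups

end RandomPoset

theorem mainTheorem2 {P : Type*} [PartialOrder P] (hP : RandomPoset.IsRandomPoset P) :
    -- the generating permutations exist
    (∃ r : Equiv.Perm P, RandomPoset.IsReversal r) ∧
    (∃ F : Set P, RandomPoset.IsRandomFilter F) ∧
    (∀ F : Set P, RandomPoset.IsRandomFilter F →
      ∃ t : Equiv.Perm P, RandomPoset.IsTurn F t) ∧
    -- whichever of them are chosen, the groups they generate are as described
    (∀ (r : Equiv.Perm P) (F : Set P) (t : Equiv.Perm P),
      RandomPoset.IsReversal r → RandomPoset.IsRandomFilter F → RandomPoset.IsTurn F t →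
      RandomPoset.groupR r = RandomPoset.autBinary (RandomPoset.Incomp (P := P)) ∧
      RandomPoset.groupT t = RandomPoset.autTernary (RandomPoset.Cyc (P := P)) ∧
      RandomPoset.groupM r t = RandomPoset.autTernary (RandomPoset.Pari (P := P)) ∧
      -- `cyc` and `pari` are the orbits under `T` of the chains and of the antichains of size three
      (∀ a b c : P, a < b → b < c →
        RandomPoset.tripleOrbit (RandomPoset.groupT t) a b c =
          {v | RandomPoset.Cyc v.1 v.2.1 v.2.2}) ∧
      (∀ a b c : P, RandomPoset.Incomp a b → RandomPoset.Incomp b c → RandomPoset.Incomp c a →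
        RandomPoset.tripleOrbit (RandomPoset.groupT t) a b c =
          {v | RandomPoset.Pari v.1 v.2.1 v.2.2})) := by
  have := hP.countable
  have hE := hP.hasExtensions
  refine ⟨hE.exists_isReversal, hP.exists_isRandomFilter, fun F hF => hF.exists_isTurn hE,
    fun r F t hr hF ht => ⟨RandomPoset.groupR_eq hE hr, RandomPoset.groupT_eq hP hF ht,
      RandomPoset.groupM_eq hP hF hr ht, fun a b c => RandomPoset.tripleOrbit_cyc hP hF ht,
      fun a b c => RandomPoset.tripleOrbit_pari hP hF ht⟩⟩
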